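/- Let $p\in\mathbb{R}[x_1,x_2]$ be a polynomial of degree $4$, let $\mathcal{C}=\{x\in\mathbb{R}^2 : p(x)=0\}$ and let $\mathcal{P}=\mathrm{conv}\,\mathcal{C}$. Assume that $\mathcal{P}$ is closed with non-empty interior, and that the sign of $p$ is such that $\{x\in\mathbb{R}^2 : p(x)\ge 0\}\subseteq\mathcal{P}$ and $p$ takes a positive value somewhere. For a real vector $y=(y_\alpha)$ indexed by the exponents $\alpha=(\alpha_1,\alpha_2)$ of the $15$ bivariate monomials of degree at most $4$, let $M_2(y)=(y_{\alpha+\beta})_{|\alpha|,|\beta|\le 2}$ be its $6\times 6$ moment matrix and $M_0(py)=\sum_\alpha p_\alpha y_\alpha$, where $p(x)=\sum_\alpha p_\alpha x^\alpha$. The first Lasserre relaxation of $\mathcal{P}$ is $$\mathcal{P}_2=\{x\in\mathbb{R}^2 : \exists\, y,\ y_{00}=1,\ y_{10}=x_1,\ y_{01}=x_2,\ M_2(y)\succeq 0,\ M_0(py)=0\}.$$ Let $\mathcal{F}$ be the dual cone of all $(f_0,f_1,f_2)\in\mathbb{R}^3$ such that $f(x)=f_0+f_1x_1+f_2x_2\ge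 0$ for all $x\in\mathcal{P}$; its non-zero elements are regarded as homogeneous coordinates, so that $f$ and $cf$ with $c>0$ define the same half-plane $\{f\geq 0\}$. For each $f$ put $p_f(x)=f(x)-p(x)$. Then the first relaxation is exact, i.e. $\mathcal{P}=\mathcal{P}_2$, if and only if every non-constant $f\in\mathcal{F}$ can be scaled by some $c>0$ so that the quartic $p_{cf}=cf-p$ satisfies $p_{cf}(x)\ge 0$ for all $x\in\mathbb{R}^2$. Moreover $\mathcal{P}_2$ (and hence $\mathcal{P}$, when the relaxation is exact) has a semidefinite representation with at most $12$ lifting variables: there are $m\le 12$, a size $n$ and real symmetric $n\times n$ matrices $F_0,F_1,F_2,G_1,\dots,G_m$ with $$\mathcal{P}_2=\Big\{x\in\mathbb{R}^2 : \exists\, y\in\mathbb{R}^m,\ F_0+x_1F_1+x_2F_2+\sum_{j=1}^m y_jG_j\succeq 0\Big\}.$$ -/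

import Mathlib

noncomputable section

namespace PlaneQuartic

open MvPolynomial

/-- The real affine curve `C = {x ∈ ℝ² : p(x) = 0}`. -/
def curve (p : MvPolynomial (Fin 2) ℝ) : Set (Fin 2 → ℝ) :=
  {x | eval x p = 0}

/-- `P = conv C`, the convex hull of the curve. -/
def hull (p : MvPolynomial (Fin 2) ℝ) : Set (Fin 2 → ℝ) :=
  convexHull ℝ (curve p)

/-- Exponents `α = (α₁, α₂)` of the bivariate monomials of degree at most `d`. -/
abbrev Mono (d : ℕ) : Type :=
  {a : Fin (d + 1) × Fin (d + 1) // a.1.val + a.2.val ≤ d}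

/-- The exponent of a monomial as a finitely supported function. -/
def Mono.toFinsupp {d : ℕ} (a : Mono d) : Fin 2 →₀ ℕ :=
  Finsupp.single 0 a.1.1.val + Finsupp.single 1 a.1.2.val

/-- The sum of two exponents of degree at most `k`, of degree at most `2k`. -/
def Mono.add {k : ℕ} (a b : Mono k) : Mono (2 * k) :=
  ⟨(⟨a.1.1.val + b.1.1.val, by have := a.2; have := b.2; omega⟩,
    ⟨a.1.2.val + b.1.2.val, by have := a.2; have := b.2; omega⟩),
    by have := a.2; have := b.2; simp only; omega⟩

/-- The linear form `q = ∑ q_α x^α ↦ ∑ q_α y_α` attached to a truncated vector of moments `y`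
(used for polynomials `q` of degree at most `d`). -/
def riesz {d : ℕ} (y : Mono d → ℝ) (q : MvPolynomial (Fin 2) ℝ) : ℝ :=
  ∑ a : Mono d, coeff a.toFinsupp q * y a

/-- The truncated moment matrix `M_k(y)`, with entries `y_{α+β}`. -/
def momentMatrix (k : ℕ) (y : Mono (2 * k) → ℝ) : Matrix (Mono k) (Mono k) ℝ :=
  Matrix.of fun a b => y (a.add b)

/-- The truncated localising matrix `M_r(p y)`, with entries `∑_γ p_γ y_{α+β+γ}`. -/
def localizingMatrix (p : MvPolynomial (Fin 2) ℝ) (r : ℕ) {d : ℕ} (y : Mono d → ℝ) :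
    Matrix (Mono r) (Mono r) ℝ :=
  Matrix.of fun a b => riesz y (monomial (a.toFinsupp + b.toFinsupp) 1 * p)

/-- Lasserre's relaxation `P_k` (for a quartic `p` and `k ≥ 2`), in the affine chart `x₀ = 1`. -/
def relaxation (p : MvPolynomial (Fin 2) ℝ) (k : ℕ) : Set (Fin 2 → ℝ) :=
  {x | ∃ y : Mono (2 * k) → ℝ,
    riesz y 1 = 1 ∧ riesz y (X 0) = x 0 ∧ riesz y (X 1) = x 1 ∧
    (momentMatrix k y).PosSemidef ∧ localizingMatrix p (k - 2) y = 0}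

/-- The affine polynomial `f(x) = f₀ + f₁ x₁ + f₂ x₂` with coefficient vector `f`. -/
def affineForm (f : Fin 3 → ℝ) : MvPolynomial (Fin 2) ℝ :=
  C (f 0) + C (f 1) * X 0 + C (f 2) * X 1

/-- The dual cone `F`: coefficients of the affine functions that are non-negative on `conv C`. -/
def dualCone (p : MvPolynomial (Fin 2) ℝ) : Set (Fin 3 → ℝ) :=
  {f | ∀ x ∈ hull p, 0 ≤ eval x (affineForm f)}

/-- The quartic `p_f = f - p`. -/
def pf (p : MvPolynomial (Fin 2) ℝ) (f : Fin 3 → ℝ) : MvPolynomial (Fin 2) ℝ :=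
  affineForm f - p

/-- `S ⊆ ℝ²` has a semidefinite representation with `m` lifting variables: it is the projection
of the feasible set of a linear matrix inequality in `(x, y)` with `y ∈ ℝ^m`. -/
def HasSemidefiniteRep (S : Set (Fin 2 → ℝ)) (m : ℕ) : Prop :=
  ∃ (n : ℕ) (F : Fin 3 → Matrix (Fin n) (Fin n) ℝ) (G : Fin m → Matrix (Fin n) (Fin n) ℝ),
    (∀ i, (F i).IsSymm) ∧ (∀ j, (G j).IsSymm) ∧
    S = {x | ∃ y : Fin m → ℝ,
      (F 0 + x 0 • F 1 + x 1 • F 2 + ∑ j, y j • G j).PosSemidef}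

end PlaneQuartic

end

/-!
For a non-constant `f` in the dual cone, exactness of the relaxation is a question of signs. If the
relaxation equals the hull, then `f ≥ 0` at the barycentre of every two-point measure integrating
`p` to zero. This says that the quotients `f / p` over `{p > 0}` dominate those over `{p < 0}`, so
with `l` the infimum of the former, `f - l * p ≥ 0` on the plane
(`exists_scaling_of_relaxation_subset`). Here `l ≠ 0` because a non-constant affine function takes
negative values, so `f` can be scaled by `1 / l`.

Conversely, a point of the relaxation outside the closed convex hull is cut off by a non-constant
`f` of the dual cone. If `c f - p ≥ 0` everywhere, then the linear form of the moment vector is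
non-negative on `c f - p`, which contradicts `L(p) = 0` and `f(x) < 0`. The non-negativity is
Hilbert's theorem that non-negative ternary quartics are sums of squares, used in its dual form
`riesz_nonneg_of_nonneg`.

Hilbert's theorem is proved as follows. Adding a small multiple of `(1 + x² + y²)²` makes the quartic
coercive; subtracting its minimum and translating gives a zero at the origin, so the quartic becomes
`Q₂ + Q₃ + Q₄` with `Qᵢ` homogeneous of degree `i`. It is non-negative exactly when the binary matrix
`[[Q₂, Q₃/2], [Q₃/2, Q₄]]` is positive semidefinite, which in the variable `t = y / x` is a univariate
polynomial matrix `[[a, b], [b, c]]` of degrees `2, 3, 4`. A further perturbation makes it generic.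
Let `μ` be the minimum of `det / a`. Subtracting `μ` from `c` makes the matrix singular at some real
`t₀`, and a constant shear then lets the factor `t - t₀` split off (`exists_split_off`). Two such steps
bring the degrees down to `2, 1, 0`, where completing the square ends the proof. Undoing the
substitutions writes the quartic as five squares (`exists_five_squares`).

The semidefinite representation takes the twelve moments of degree at least two as lifting
variables, and encodes the equation `L(p) = 0` by two diagonal entries `L(p)` and `-L(p)`.
-/

noncomputable section

namespace PlaneQuartic

section Moments

open MvPolynomial

/-! ### Moment functionals and the relaxation -/

lemma Mono.toFinsupp_zero {d : ℕ} (a : Mono d) : a.toFinsupp 0 = a.1.1.val := by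
  simp [Mono.toFinsupp]

lemma Mono.toFinsupp_one {d : ℕ} (a : Mono d) : a.toFinsupp 1 = a.1.2.val := by
  simp [Mono.toFinsupp]

lemma Mono.toFinsupp_injective {d : ℕ} :
    Function.Injective (Mono.toFinsupp : Mono d → (Fin 2 →₀ ℕ)) := by
  intro a b h
  have h0 := DFunLike.congr_fun h 0
  have h1 := DFunLike.congr_fun h 1
  rw [toFinsupp_zero, toFinsupp_zero] at h0
  rw [toFinsupp_one, toFinsupp_one] at h1
  exact Subtype.ext (Prod.ext (Fin.ext h0) (Fin.ext h1))

lemma Mono.toFinsupp_add {k : ℕ} (a b : Mono k) :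
    (a.add b).toFinsupp = a.toFinsupp + b.toFinsupp := by
  ext i
  fin_cases i <;> simp [Mono.toFinsupp, Mono.add]

lemma Mono.exists_toFinsupp_eq {d : ℕ} (s : Fin 2 →₀ ℕ) (hs : s 0 + s 1 ≤ d) :
    ∃ a : Mono d, a.toFinsupp = s := by
  refine ⟨⟨(⟨s 0, by omega⟩, ⟨s 1, by omega⟩), hs⟩, ?_⟩
  ext i
  fin_cases i <;> simp [Mono.toFinsupp]

/-- A polynomial of degree at most `d` is the sum of its terms with exponents in `Mono d`. -/
lemma sum_monomial_of_totalDegree_le {d : ℕ} {q : MvPolynomial (Fin 2) ℝ}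
    (hq : q.totalDegree ≤ d) :
    q = ∑ a : Mono d, monomial a.toFinsupp (coeff a.toFinsupp q) := by
  ext s
  simp only [coeff_sum, coeff_monomial]
  by_cases hs : s 0 + s 1 ≤ d
  · obtain ⟨a, rfl⟩ := Mono.exists_toFinsupp_eq s hs
    simp [Mono.toFinsupp_injective.eq_iff]
  · have h0 : coeff s q = 0 := by
      apply coeff_eq_zero_of_totalDegree_lt
      rw [← Finsupp.degree_apply, Finsupp.degree_eq_sum, Fin.sum_univ_two]
      omega
    rw [h0, eq_comm]
    apply Finset.sum_eq_zero
    intro a _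
    rw [if_neg]
    rintro rfl
    rw [Mono.toFinsupp_zero, Mono.toFinsupp_one] at hs
    exact hs a.2

/-- `riesz y` as a linear form on all polynomials. -/
def rieszₗ {d : ℕ} (y : Mono d → ℝ) : MvPolynomial (Fin 2) ℝ →ₗ[ℝ] ℝ where
  toFun := riesz y
  map_add' p q := by simp [riesz, add_mul, Finset.sum_add_distrib]
  map_smul' c p := by simp [riesz, Finset.mul_sum, mul_assoc]

lemma rieszₗ_apply {d : ℕ} (y : Mono d → ℝ) (q : MvPolynomial (Fin 2) ℝ) :
    rieszₗ y q = riesz y q := rfl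

lemma riesz_combo {d : ℕ} (y z : Mono d → ℝ) (s t : ℝ) (q : MvPolynomial (Fin 2) ℝ) :
    riesz (s • y + t • z) q = s * riesz y q + t * riesz z q := by
  simp only [riesz, Finset.mul_sum, ← Finset.sum_add_distrib, Pi.add_apply, Pi.smul_apply,
    smul_eq_mul]
  exact Finset.sum_congr rfl fun _ _ => by ring

lemma riesz_monomial {d : ℕ} (y : Mono d → ℝ) (a : Mono d) (r : ℝ) :
    riesz y (monomial a.toFinsupp r) = r * y a := by
  simp [riesz, coeff_monomial, Mono.toFinsupp_injective.eq_iff]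

/-- A functional with positive semidefinite moment matrix is non-negative on squares. -/
lemma riesz_mul_self_nonneg {k : ℕ} {y : Mono (2 * k) → ℝ} (hy : (momentMatrix k y).PosSemidef)
    {g : MvPolynomial (Fin 2) ℝ} (hg : g.totalDegree ≤ k) : 0 ≤ riesz y (g * g) := by
  have key : riesz y (g * g) =
      ∑ a : Mono k, ∑ b : Mono k, coeff a.toFinsupp g * coeff b.toFinsupp g * y (a.add b) := by
    conv_lhs => rw [sum_monomial_of_totalDegree_le hg]
    simp only [Finset.sum_mul_sum, monomial_mul, ← rieszₗ_apply, map_sum]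
    simp only [rieszₗ_apply, ← Mono.toFinsupp_add, riesz_monomial]
  rw [key]
  have h := hy.dotProduct_mulVec_nonneg (fun a : Mono k => coeff a.toFinsupp g)
  refine h.trans_eq ?_
  simp only [dotProduct, Matrix.mulVec, momentMatrix, Matrix.of_apply, Finset.mul_sum,
    Pi.star_apply, star_trivial]
  exact Finset.sum_congr rfl fun _ _ => Finset.sum_congr rfl fun _ _ => by ring

/-- The moments `x^α` of the point `x`. -/
def pointMoment (d : ℕ) (x : Fin 2 → ℝ) (a : Mono d) : ℝ :=
  x 0 ^ a.1.1.val * x 1 ^ a.1.2.val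

lemma eval_eq_sum {d : ℕ} {q : MvPolynomial (Fin 2) ℝ} (hq : q.totalDegree ≤ d)
    (x : Fin 2 → ℝ) : eval x q = ∑ a : Mono d, coeff a.toFinsupp q * pointMoment d x a := by
  conv_lhs => rw [sum_monomial_of_totalDegree_le hq]
  simp [eval_monomial, Finsupp.prod_fintype, Fin.prod_univ_two, Mono.toFinsupp_zero,
    Mono.toFinsupp_one, pointMoment]

lemma riesz_pointMoment {d : ℕ} {q : MvPolynomial (Fin 2) ℝ} (hq : q.totalDegree ≤ d)
    (x : Fin 2 → ℝ) : riesz (pointMoment d x) q = eval x q :=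
  (eval_eq_sum hq x).symm

lemma momentMatrix_pointMoment_posSemidef (k : ℕ) (x : Fin 2 → ℝ) :
    (momentMatrix k (pointMoment (2 * k) x)).PosSemidef := by
  have : momentMatrix k (pointMoment (2 * k) x) =
      Matrix.vecMulVec (pointMoment k x) (star (pointMoment k x)) := by
    ext a b
    simp only [momentMatrix, Matrix.of_apply, Matrix.vecMulVec_apply, pointMoment, Mono.add,
      star_trivial]
    ring
  rw [this]
  exact Matrix.posSemidef_vecMulVec_self_star _

lemma momentMatrix_combo (k : ℕ) (y z : Mono (2 * k) → ℝ) (s t : ℝ) :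
    momentMatrix k (s • y + t • z) = s • momentMatrix k y + t • momentMatrix k z := by
  ext a b
  simp [momentMatrix]

/-- The order-zero localising matrix is the scalar `riesz y p`. -/
lemma localizingMatrix_zero_iff (p : MvPolynomial (Fin 2) ℝ) {d : ℕ} (y : Mono d → ℝ) :
    localizingMatrix p (2 - 2) y = 0 ↔ riesz y p = 0 := by
  have hz : ∀ a : Mono (2 - 2), a.toFinsupp = 0 := by
    intro a
    ext i
    fin_cases i <;> simp [Mono.toFinsupp]
  constructor
  · intro h
    have h1 := congr_fun (congr_fun h ⟨(0, 0), by simp⟩) ⟨(0, 0), by simp⟩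
    simpa [localizingMatrix, hz] using h1
  · intro h
    ext a b
    simp [localizingMatrix, hz, h]

lemma mem_relaxation_two {p : MvPolynomial (Fin 2) ℝ} {x : Fin 2 → ℝ} :
    x ∈ relaxation p 2 ↔ ∃ y : Mono (2 * 2) → ℝ,
      riesz y 1 = 1 ∧ riesz y (X 0) = x 0 ∧ riesz y (X 1) = x 1 ∧
      (momentMatrix 2 y).PosSemidef ∧ riesz y p = 0 := by
  simp only [relaxation, Set.mem_ofPred_eq, localizingMatrix_zero_iff]

lemma convex_relaxation_two (p : MvPolynomial (Fin 2) ℝ) : Convex ℝ (relaxation p 2) := by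
  intro x hx x' hx' s t hs ht hst
  rw [mem_relaxation_two] at *
  obtain ⟨y, h1, h2, h3, h4, h5⟩ := hx
  obtain ⟨z, k1, k2, k3, k4, k5⟩ := hx'
  refine ⟨s • y + t • z, ?_, ?_, ?_, ?_, ?_⟩
  · rw [riesz_combo, h1, k1, mul_one, mul_one, hst]
  · rw [riesz_combo, h2, k2]; simp
  · rw [riesz_combo, h3, k3]; simp
  · rw [momentMatrix_combo]
    exact (h4.smul hs).add (k4.smul ht)
  · rw [riesz_combo, h5, k5, mul_zero, mul_zero, add_zero]

/-- The barycentre of a two-point probability measure that integrates `p` to zero lies in the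
relaxation. -/
lemma combo_mem_relaxation_two {p : MvPolynomial (Fin 2) ℝ} (hdeg : p.totalDegree ≤ 4)
    {x x' : Fin 2 → ℝ} {s t : ℝ} (hs : 0 ≤ s) (ht : 0 ≤ t) (hst : s + t = 1)
    (hp : s * eval x p + t * eval x' p = 0) : s • x + t • x' ∈ relaxation p 2 := by
  rw [mem_relaxation_two]
  have hX : ∀ i : Fin 2, (X i : MvPolynomial (Fin 2) ℝ).totalDegree ≤ 2 * 2 := fun i => by
    rw [totalDegree_X]; norm_num
  refine ⟨s • pointMoment (2 * 2) x + t • pointMoment (2 * 2) x', ?_, ?_, ?_, ?_, ?_⟩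
  · rw [riesz_combo, riesz_pointMoment (by simp), riesz_pointMoment (by simp)]
    simpa using hst
  · rw [riesz_combo, riesz_pointMoment (hX 0), riesz_pointMoment (hX 0)]; simp
  · rw [riesz_combo, riesz_pointMoment (hX 1), riesz_pointMoment (hX 1)]; simp
  · rw [momentMatrix_combo]
    exact ((momentMatrix_pointMoment_posSemidef 2 x).smul hs).add
      ((momentMatrix_pointMoment_posSemidef 2 x').smul ht)
  · rw [riesz_combo, riesz_pointMoment hdeg, riesz_pointMoment hdeg, hp]

lemma hull_subset_relaxation_two {p : MvPolynomial (Fin 2) ℝ} (hdeg : p.totalDegree ≤ 4) :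
    hull p ⊆ relaxation p 2 := by
  refine convexHull_min (fun x hx => ?_) (convex_relaxation_two p)
  have hx0 : eval x p = 0 := hx
  have := combo_mem_relaxation_two hdeg (x := x) (x' := x) zero_le_one le_rfl (add_zero 1)
    (by rw [hx0]; ring)
  simpa using this

/-! ### From exactness to scalings of the dual cone -/

lemma eval_affineForm (f : Fin 3 → ℝ) (x : Fin 2 → ℝ) :
    eval x (affineForm f) = f 0 + f 1 * x 0 + f 2 * x 1 := by
  simp [affineForm]

lemma totalDegree_affineForm_le (f : Fin 3 → ℝ) : (affineForm f).totalDegree ≤ 1 := by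
  have hX : ∀ (r : ℝ) (i : Fin 2), (C r * X i : MvPolynomial (Fin 2) ℝ).totalDegree ≤ 1 := by
    intro r i
    refine (totalDegree_mul _ _).trans ?_
    rw [totalDegree_C, totalDegree_X]
  refine (totalDegree_add _ _).trans (max_le ((totalDegree_add _ _).trans (max_le ?_ (hX _ _)))
    (hX _ _))
  simp

lemma riesz_affineForm {d : ℕ} (y : Mono d → ℝ) (f : Fin 3 → ℝ) :
    riesz y (affineForm f) = f 0 * riesz y 1 + f 1 * riesz y (X 0) + f 2 * riesz y (X 1) := by
  have : affineForm f = f 0 • (1 : MvPolynomial (Fin 2) ℝ) + f 1 • X 0 + f 2 • X 1 := by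
    simp [affineForm, smul_eq_C_mul]
  rw [this]
  simp only [← rieszₗ_apply, map_add, map_smul, smul_eq_mul]

lemma totalDegree_pf_le {p : MvPolynomial (Fin 2) ℝ} (hp : p.totalDegree ≤ 4) (f : Fin 3 → ℝ) :
    (pf p f).totalDegree ≤ 4 :=
  (totalDegree_sub _ _).trans
    (max_le ((totalDegree_affineForm_le f).trans (by norm_num)) hp)

lemma riesz_pf {d : ℕ} (y : Mono d → ℝ) (p : MvPolynomial (Fin 2) ℝ) (f : Fin 3 → ℝ) :
    riesz y (pf p f) =
      f 0 * riesz y 1 + f 1 * riesz y (X 0) + f 2 * riesz y (X 1) - riesz y p := by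
  rw [← riesz_affineForm]
  exact map_sub (rieszₗ y) _ _

lemma eval_pf_smul (p : MvPolynomial (Fin 2) ℝ) (c : ℝ) (f : Fin 3 → ℝ) (x : Fin 2 → ℝ) :
    eval x (pf p (c • f)) = c * eval x (affineForm f) - eval x p := by
  simp only [pf, map_sub, eval_affineForm, Pi.smul_apply, smul_eq_mul]
  ring

/-- If the relaxation is exact then a non-constant `f` in the dual cone has `f - l * p ≥ 0`
everywhere for some `l > 0`: two-point measures integrating `p` to zero separate the quotients
`f / p` over `{p > 0}` from those over `{p < 0}`, and `l` is the infimum of the former. -/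
lemma exists_scaling_of_relaxation_subset {p : MvPolynomial (Fin 2) ℝ}
    (hdeg : p.totalDegree ≤ 4) (hsign : {x : Fin 2 → ℝ | 0 ≤ eval x p} ⊆ hull p)
    (hpos : ∃ x : Fin 2 → ℝ, 0 < eval x p) (hex : relaxation p 2 ⊆ hull p)
    {f : Fin 3 → ℝ} (hf : f ∈ dualCone p) (hne : f 1 ≠ 0 ∨ f 2 ≠ 0) :
    ∃ c : ℝ, 0 < c ∧ ∀ x : Fin 2 → ℝ, 0 ≤ eval x (pf p (c • f)) := by
  set F : (Fin 2 → ℝ) → ℝ := fun x => eval x (affineForm f) with hF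
  have hFn : ∀ x, 0 ≤ eval x p → 0 ≤ F x := fun x hx => hf x (hsign hx)
  have pair : ∀ x x', 0 < eval x p → eval x' p < 0 → F x' / eval x' p ≤ F x / eval x p := by
    intro x x' hx hx'
    have hd : 0 < eval x p - eval x' p := by linarith
    -- the weights are those for which the two-point measure integrates `p` to zero
    have hmem := combo_mem_relaxation_two hdeg (x := x) (x' := x')
      (s := -eval x' p / (eval x p - eval x' p)) (t := eval x p / (eval x p - eval x' p))
      (div_nonneg (by linarith) hd.le) (div_nonneg hx.le hd.le)
      (by field_simp; ring) (by field_simp; ring)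
    have h0 := hf _ (hex hmem)
    rw [eval_affineForm] at h0
    simp only [Pi.add_apply, Pi.smul_apply, smul_eq_mul] at h0
    have h1 : 0 ≤ (-eval x' p * F x + eval x p * F x') / (eval x p - eval x' p) := by
      refine h0.trans_eq ?_
      simp only [hF, eval_affineForm]
      field_simp
      ring
    have h2 : 0 ≤ -eval x' p * F x + eval x p * F x' := by
      by_contra hcon
      exact absurd h1 (not_le.mpr (div_neg_of_neg_of_pos (not_le.mp hcon) hd))
    rw [div_le_iff_of_neg hx', div_mul_eq_mul_div, div_le_iff₀ hx]
    linarith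
  set S : Set ℝ := (fun x => F x / eval x p) '' {x | 0 < eval x p} with hS
  obtain ⟨x₀, hx₀⟩ := hpos
  have hSne : S.Nonempty := ⟨_, x₀, hx₀, rfl⟩
  set l := sInf S with hl
  have hl0 : 0 ≤ l := by
    apply le_csInf hSne
    rintro _ ⟨x, hx, rfl⟩
    exact div_nonneg (hFn x (le_of_lt hx)) (le_of_lt hx)
  have hbdd : BddBelow S := by
    refine ⟨0, ?_⟩
    rintro _ ⟨x, hx, rfl⟩
    exact div_nonneg (hFn x (le_of_lt hx)) (le_of_lt hx)
  have main : ∀ x, l * eval x p ≤ F x := by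
    intro x
    rcases lt_trichotomy (eval x p) 0 with hx | hx | hx
    · have : F x / eval x p ≤ l := by
        apply le_csInf hSne
        rintro _ ⟨z, hz, rfl⟩
        exact pair z x hz hx
      rwa [div_le_iff_of_neg hx] at this
    · rw [hx, mul_zero]
      exact hFn x hx.ge
    · have : l ≤ F x / eval x p := csInf_le hbdd ⟨x, hx, rfl⟩
      rwa [le_div_iff₀ hx] at this
  have hlpos : 0 < l := by
    refine lt_of_le_of_ne hl0 fun h => ?_
    have hall : ∀ x, 0 ≤ F x := fun x => by simpa [← h] using main x
    -- far out in the direction of minus its gradient, a non-constant affine form is negative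
    have hg : 0 < f 1 ^ 2 + f 2 ^ 2 := by
      rcases hne with h | h <;> positivity
    have h1 := hall ![-(|f 0| + 1) / (f 1 ^ 2 + f 2 ^ 2) * f 1,
      -(|f 0| + 1) / (f 1 ^ 2 + f 2 ^ 2) * f 2]
    simp only [hF, eval_affineForm, Matrix.cons_val_zero, Matrix.cons_val_one] at h1
    have h2 : f 0 + f 1 * (-(|f 0| + 1) / (f 1 ^ 2 + f 2 ^ 2) * f 1) +
        f 2 * (-(|f 0| + 1) / (f 1 ^ 2 + f 2 ^ 2) * f 2) = f 0 - (|f 0| + 1) := by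
      field_simp
      ring
    rw [h2] at h1
    linarith [le_abs_self (f 0)]
  refine ⟨1 / l, by positivity, fun x => ?_⟩
  rw [eval_pf_smul]
  have : eval x p ≤ F x / l := by
    rw [le_div_iff₀ hlpos]; linarith [main x]
  have h3 : 1 / l * eval x (affineForm f) = F x / l := by simp only [hF]; ring
  rw [h3]; linarith

/-- A closed convex set in the plane is cut out by non-constant affine inequalities. -/
lemma exists_mem_dualCone_neg {p : MvPolynomial (Fin 2) ℝ} (hclosed : IsClosed (hull p))
    (hne : (hull p).Nonempty) {x : Fin 2 → ℝ} (hx : x ∉ hull p) :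
    ∃ f ∈ dualCone p, (f 1 ≠ 0 ∨ f 2 ≠ 0) ∧ eval x (affineForm f) < 0 := by
  obtain ⟨g, u, hgx, hg⟩ :=
    geometric_hahn_banach_point_closed (convex_convexHull ℝ (curve p)) hclosed hx
  have hexp : ∀ z : Fin 2 → ℝ, g z = g (Pi.single 0 1) * z 0 + g (Pi.single 1 1) * z 1 := by
    intro z
    have hz : z = z 0 • Pi.single 0 1 + z 1 • Pi.single 1 1 := by
      ext i; fin_cases i <;> simp
    conv_lhs => rw [hz]
    simp only [map_add, map_smul, smul_eq_mul]
    ring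
  have hev : ∀ z, eval z (affineForm ![-u, g (Pi.single 0 1), g (Pi.single 1 1)]) = g z - u := by
    intro z
    rw [eval_affineForm, hexp z]
    simp
    ring
  refine ⟨![-u, g (Pi.single 0 1), g (Pi.single 1 1)], fun z hz => ?_, ?_, ?_⟩
  · rw [hev]; linarith [hg z hz]
  · by_contra hcon
    push Not at hcon
    simp only [Matrix.cons_val_one, Matrix.cons_val_zero, Matrix.cons_val] at hcon
    obtain ⟨z, hz⟩ := hne
    have h1 := hg z hz
    rw [hexp] at h1 hgx
    rw [hcon.1, hcon.2] at h1 hgx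
    linarith
  · rw [hev]; linarith

/-! ### Semidefinite representation -/

/-- The exponents of degree at least two: their moments are the lifting variables. -/
abbrev HighMono : Type := {a : Mono (2 * 2) // 2 ≤ a.1.1.val + a.1.2.val}

lemma card_highMono : Fintype.card HighMono = 12 := by decide +kernel

/-- The exponents `(0,0)`, `(1,0)`, `(0,1)` of the affine coordinates. -/
def lowMono : Fin 3 → Mono (2 * 2) :=
  ![⟨(0, 0), by simp⟩, ⟨(1, 0), by simp⟩, ⟨(0, 1), by simp⟩]

lemma toFinsupp_lowMono_zero : (lowMono 0).toFinsupp = 0 := by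
  simp [lowMono, Mono.toFinsupp]

lemma toFinsupp_lowMono_one : (lowMono 1).toFinsupp = Finsupp.single 0 1 := by
  simp [lowMono, Mono.toFinsupp]

lemma toFinsupp_lowMono_two : (lowMono 2).toFinsupp = Finsupp.single 1 1 := by
  simp [lowMono, Mono.toFinsupp]

lemma riesz_one_eq (y : Mono (2 * 2) → ℝ) : riesz y 1 = y (lowMono 0) := by
  have := riesz_monomial y (lowMono 0) 1
  rwa [toFinsupp_lowMono_zero, one_mul] at this

lemma riesz_X_zero_eq (y : Mono (2 * 2) → ℝ) : riesz y (X 0) = y (lowMono 1) := by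
  have := riesz_monomial y (lowMono 1) 1
  rwa [toFinsupp_lowMono_one, one_mul] at this

lemma riesz_X_one_eq (y : Mono (2 * 2) → ℝ) : riesz y (X 1) = y (lowMono 2) := by
  have := riesz_monomial y (lowMono 2) 1
  rwa [toFinsupp_lowMono_two, one_mul] at this

lemma exists_lowMono_eq (a : Mono (2 * 2)) (ha : ¬ 2 ≤ a.1.1.val + a.1.2.val) :
    ∃ i, lowMono i = a := by
  revert a
  decide +kernel

lemma lowMono_injective : Function.Injective lowMono := by decide +kernel

lemma lowMono_ne (i : Fin 3) (b : HighMono) : lowMono i ≠ b.1 := by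
  revert i b
  decide +kernel

/-- The moment vector with moments `u` of degree at most one and higher moments `w`. -/
def assemble (u : Fin 3 → ℝ) (w : HighMono → ℝ) : Mono (2 * 2) → ℝ :=
  ∑ i, u i • Pi.single (lowMono i) 1 + ∑ b, w b • Pi.single b.1 1

lemma assemble_lowMono (u : Fin 3 → ℝ) (w : HighMono → ℝ) (i : Fin 3) :
    assemble u w (lowMono i) = u i := by
  simp [assemble, Pi.single_apply, lowMono_injective.eq_iff, lowMono_ne]

lemma assemble_highMono (u : Fin 3 → ℝ) (w : HighMono → ℝ) (b : HighMono) :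
    assemble u w b.1 = w b := by
  simp [assemble, Pi.single_apply, (lowMono_ne _ b).symm, Subtype.coe_inj]

lemma assemble_self (y : Mono (2 * 2) → ℝ) :
    assemble (fun i => y (lowMono i)) (fun b => y b.1) = y := by
  ext a
  by_cases ha : 2 ≤ a.1.1.val + a.1.2.val
  · exact assemble_highMono _ _ ⟨a, ha⟩
  · obtain ⟨i, rfl⟩ := exists_lowMono_eq a ha
    exact assemble_lowMono _ _ i

/-- The block-diagonal matrix `diag (M₂(y), L(p), -L(p))`, where `L` is the linear form of `y`: it
is positive semidefinite exactly when `M₂(y)` is and `L(p) = 0`. -/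
def constraintMatrix (p : MvPolynomial (Fin 2) ℝ) :
    (Mono (2 * 2) → ℝ) →ₗ[ℝ] Matrix (Mono 2 ⊕ Fin 2) (Mono 2 ⊕ Fin 2) ℝ where
  toFun y := Matrix.fromBlocks (momentMatrix 2 y) 0 0
    (Matrix.diagonal ![riesz y p, -riesz y p])
  map_add' y z := by
    have h := riesz_combo y z 1 1 p
    rw [one_smul, one_smul, one_mul, one_mul] at h
    rw [h, Matrix.fromBlocks_add]
    congr 1
    · simp
    · simp
    · ext i j
      fin_cases i <;> fin_cases j <;> simp
      ring
  map_smul' c y := by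
    have h := riesz_combo y 0 c 0 p
    rw [smul_zero, add_zero, zero_mul, add_zero] at h
    rw [h, RingHom.id_apply, Matrix.fromBlocks_smul]
    congr 1
    · simp
    · simp
    · ext i j
      fin_cases i <;> fin_cases j <;> simp

lemma constraintMatrix_apply (p : MvPolynomial (Fin 2) ℝ) (y : Mono (2 * 2) → ℝ) :
    constraintMatrix p y = Matrix.fromBlocks (momentMatrix 2 y) 0 0
      (Matrix.diagonal ![riesz y p, -riesz y p]) := rfl

lemma isSymm_constraintMatrix (p : MvPolynomial (Fin 2) ℝ) (y : Mono (2 * 2) → ℝ) :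
    (constraintMatrix p y).IsSymm := by
  rw [constraintMatrix_apply]
  refine Matrix.IsSymm.fromBlocks ?_ (by simp) (Matrix.isSymm_diagonal _)
  ext a b
  simp [momentMatrix, Mono.add, add_comm]

lemma posSemidef_constraintMatrix_iff (p : MvPolynomial (Fin 2) ℝ) (y : Mono (2 * 2) → ℝ) :
    (constraintMatrix p y).PosSemidef ↔ (momentMatrix 2 y).PosSemidef ∧ riesz y p = 0 := by
  constructor
  · intro h
    rw [constraintMatrix_apply] at h
    refine ⟨h.submatrix Sum.inl, ?_⟩
    have h2 : (Matrix.diagonal ![riesz y p, -riesz y p]).PosSemidef := h.submatrix Sum.inr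
    rw [Matrix.posSemidef_diagonal_iff] at h2
    have h3 := h2 0
    have h4 := h2 1
    simp only [Matrix.cons_val_zero, Matrix.cons_val_one] at h3 h4
    linarith
  · rintro ⟨h, h0⟩
    refine Matrix.PosSemidef.of_dotProduct_mulVec_nonneg ?_ fun v => ?_
    · have := isSymm_constraintMatrix p y
      rwa [Matrix.IsHermitian, Matrix.conjTranspose_eq_transpose_of_trivial]
    · have h1 := h.dotProduct_mulVec_nonneg (v ∘ Sum.inl)
      rw [constraintMatrix_apply, h0, Matrix.fromBlocks_mulVec]
      have hz : Matrix.diagonal ![(0 : ℝ), -0] = 0 := by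
        ext i j
        fin_cases i <;> fin_cases j <;> simp
      rw [hz]
      simpa [dotProduct, Fintype.sum_sum_type] using h1

lemma hasSemidefiniteRep_relaxation_two (p : MvPolynomial (Fin 2) ℝ) :
    HasSemidefiniteRep (relaxation p 2) 12 := by
  let e : Fin 12 ≃ HighMono := (Fintype.equivFinOfCardEq card_highMono).symm
  let r := Fintype.equivFin (Mono 2 ⊕ Fin 2)
  let N : (Mono (2 * 2) → ℝ) →ₗ[ℝ] Matrix (Fin _) (Fin _) ℝ :=
    (Matrix.reindexLinearEquiv ℝ ℝ r r).toLinearMap ∘ₗ constraintMatrix p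
  have hN : ∀ y, N y = (constraintMatrix p y).submatrix r.symm r.symm := fun y => rfl
  have hiff : ∀ y, (N y).PosSemidef ↔ (momentMatrix 2 y).PosSemidef ∧ riesz y p = 0 := fun y => by
    rw [hN, Matrix.posSemidef_submatrix_equiv, posSemidef_constraintMatrix_iff]
  have hsymm : ∀ y, (N y).IsSymm := fun y => by
    rw [hN]; exact (isSymm_constraintMatrix p y).submatrix _
  refine ⟨_, fun i => N (Pi.single (lowMono i) 1), fun j => N (Pi.single (e j).1 1),
    fun i => hsymm _, fun j => hsymm _, ?_⟩
  have hsum : ∀ (x : Fin 2 → ℝ) (w : Fin 12 → ℝ),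
      N (Pi.single (lowMono 0) 1) + x 0 • N (Pi.single (lowMono 1) 1) +
        x 1 • N (Pi.single (lowMono 2) 1) + ∑ j, w j • N (Pi.single (e j).1 1) =
      N (assemble ![1, x 0, x 1] (w ∘ e.symm)) := by
    intro x w
    rw [assemble, ← e.sum_comp]
    simp [Fin.sum_univ_three, map_add, map_sum, map_smul]
  ext x
  rw [mem_relaxation_two]
  simp only [Set.mem_ofPred_eq, hsum, hiff, riesz_one_eq, riesz_X_zero_eq, riesz_X_one_eq]
  constructor
  · rintro ⟨y, h0, h1, h2, hM, hp⟩
    have hy : assemble ![1, x 0, x 1] ((fun j => y (e j).1) ∘ e.symm) = y := by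
      rw [← h0, ← h1, ← h2]
      conv_rhs => rw [← assemble_self y]
      congr 1
      · ext i; fin_cases i <;> rfl
      · ext b; simp
    refine ⟨fun j => y (e j).1, ?_⟩
    rw [hy]
    exact ⟨hM, hp⟩
  · rintro ⟨w, hM, hp⟩
    refine ⟨_, ?_, ?_, ?_, hM, hp⟩ <;> rw [assemble_lowMono] <;> rfl

end Moments

section Univariate

open Polynomial

/-! ### Positive semidefinite univariate polynomial matrices -/

/-- A continuous function that is non-negative off one point is non-negative. -/
lemma nonneg_of_nonneg_off {f : ℝ → ℝ} (hf : Continuous f) (t₀ : ℝ)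
    (h : ∀ t, t ≠ t₀ → 0 ≤ f t) (t : ℝ) : 0 ≤ f t := by
  have hcl : IsClosed {t | 0 ≤ f t} := isClosed_le continuous_const hf
  have : closure ({t₀}ᶜ : Set ℝ) ⊆ {t | 0 ≤ f t} := hcl.closure_subset_iff.mpr fun t ht => h t ht
  rw [(dense_compl_singleton t₀).closure_eq] at this
  exact this (Set.mem_univ t)

/-- A real zero of a non-negative polynomial is a double zero. -/
lemma sq_dvd_of_nonneg {r : ℝ[X]} (hr : ∀ t, 0 ≤ r.eval t) {t₀ : ℝ} (h0 : r.eval t₀ = 0) :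
    (X - C t₀) ^ 2 ∣ r := by
  obtain ⟨s, rfl⟩ := dvd_iff_isRoot.mpr h0
  have hmin : IsLocalMin (fun t => eval t ((X - C t₀) * s)) t₀ :=
    Filter.Eventually.of_forall fun t => by
      simp only
      rw [h0]
      exact hr t
  have hd := hmin.hasDerivAt_eq_zero (((X - C t₀) * s).hasDerivAt t₀)
  have hs : s.eval t₀ = 0 := by simpa [derivative_mul] using hd
  obtain ⟨u, rfl⟩ := dvd_iff_isRoot.mpr hs
  exact ⟨u, by ring⟩

lemma natDegree_le_of_sub_pow_mul {q : ℝ[X]} {t₀ : ℝ} {k n : ℕ}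
    (h : ((X - C t₀) ^ k * q).natDegree ≤ n + k) : q.natDegree ≤ n := by
  by_cases hq : q = 0
  · simp [hq]
  · rw [((monic_X_sub_C t₀).pow k).natDegree_mul' hq, natDegree_pow, natDegree_X_sub_C] at h
    omega

lemma natDegree_sub_C_add_le {a b c : ℝ[X]} {n : ℕ} (hc : c.natDegree ≤ n) (hb : b.natDegree ≤ n)
    (ha : a.natDegree ≤ n) {μ r s : ℝ} : (c - C μ + C r * b + C s * a).natDegree ≤ n := by
  refine natDegree_add_le_of_degree_le (natDegree_add_le_of_degree_le
    ((natDegree_sub_le_of_le hc (natDegree_C μ).le).trans (by simp)) ?_) ?_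
  · exact (natDegree_C_mul_le _ _).trans hb
  · exact (natDegree_C_mul_le _ _).trans ha

/-- A non-negative quotient of polynomials with numerator of larger degree attains its minimum. -/
lemma exists_min_div {P Q : ℝ[X]} (hP : ∀ t, 0 ≤ P.eval t) (hQ : ∀ t, 0 < Q.eval t)
    (hdeg : Q.natDegree < P.natDegree) :
    ∃ t₀, ∀ t, P.eval t₀ / Q.eval t₀ ≤ P.eval t / Q.eval t := by
  have hQ0 : Q ≠ 0 := by
    rintro rfl
    simpa using hQ 0
  have habs : ∀ t, |P.eval t / Q.eval t| = P.eval t / Q.eval t := fun t =>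
    abs_of_nonneg (div_nonneg (hP t) (hQ t).le)
  have h1 := abs_div_tendsto_atTop_atTop_of_degree_gt P Q (degree_lt_degree hdeg) hQ0
  have h2 := abs_div_tendsto_atTop_atTop_of_degree_gt (P.comp (-X)) (Q.comp (-X))
    (by rw [degree_comp_neg_X, degree_comp_neg_X]; exact degree_lt_degree hdeg)
    (by rw [Ne, ← degree_eq_bot, degree_comp_neg_X, degree_eq_bot]; exact hQ0)
  have h3 := h2.comp Filter.tendsto_neg_atBot_atTop
  simp only [Function.comp_def, eval_comp, eval_neg, eval_X, neg_neg] at h3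
  simp only [habs] at h1 h3
  refine Continuous.exists_forall_le (f := fun t => P.eval t / Q.eval t)
    (P.continuous.div₀ Q.continuous fun t => (hQ t).ne') ?_
  rw [cocompact_eq_atBot_atTop]
  exact h3.sup h1

/-- Reduction step for a positive semidefinite polynomial matrix `[[a, b], [b, c]]` with `a > 0`.
With `μ` the minimum of `det / a`, attained at `t₀`, the matrix `[[a, b], [b, c - μ]]` is singular
at `t₀`; a constant shear moves its kernel vector to `(0, 1)`, and then `X - t₀` splits off as a
congruence by `diag (1, X - t₀)`. -/
lemma exists_split_off {a b c : ℝ[X]} (ha : ∀ t, 0 < a.eval t)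
    (hD : ∀ t, 0 ≤ (a * c - b ^ 2).eval t) (hdeg : a.natDegree < (a * c - b ^ 2).natDegree) :
    ∃ (μ t₀ z₀ : ℝ) (b' c' : ℝ[X]), 0 ≤ μ ∧ b + C z₀ * a = (X - C t₀) * b' ∧
      c - C μ + C (2 * z₀) * b + C (z₀ ^ 2) * a = (X - C t₀) ^ 2 * c' ∧
      (∀ t, 0 ≤ (a * c' - b' ^ 2).eval t) ∧
      (a * c' - b' ^ 2).natDegree + 2 = (a * c - b ^ 2).natDegree := by
  obtain ⟨t₀, ht₀⟩ := exists_min_div hD ha hdeg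
  set D := a * c - b ^ 2 with hDdef
  set μ := D.eval t₀ / a.eval t₀ with hμ
  set z₀ := -(b.eval t₀ / a.eval t₀) with hz
  have ha0 := (ha t₀).ne'
  have hDμ : ∀ t, 0 ≤ (D - C μ * a).eval t := fun t => by
    have := ht₀ t
    rw [le_div_iff₀ (ha t)] at this
    simpa using this
  have hb : (b + C z₀ * a).eval t₀ = 0 := by
    simp only [eval_add, eval_mul, eval_C, hz]
    field_simp
    ring
  obtain ⟨b', hb'⟩ := dvd_iff_isRoot.mpr hb
  obtain ⟨r, hr⟩ : ∃ r, r = c - C μ + C (2 * z₀) * b + C (z₀ ^ 2) * a := ⟨_, rfl⟩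
  have hid : a * r =
      (D - C μ * a) + (b + C z₀ * a) ^ 2 := by
    simp only [hDdef, hr, map_mul, map_pow, map_ofNat]
    ring
  have hc : ∀ t, 0 ≤ r.eval t := fun t => by
    have h1 := congrArg (eval t) hid
    rw [eval_mul, eval_add, eval_pow] at h1
    have h2 : 0 ≤ a.eval t * r.eval t := by
      rw [h1]; exact add_nonneg (hDμ t) (sq_nonneg _)
    exact nonneg_of_mul_nonneg_right h2 (ha t)
  have hc0 : r.eval t₀ = 0 := by
    have h1 := congrArg (eval t₀) hid
    rw [eval_mul, eval_add, eval_pow, hb] at h1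
    have h2 : (D - C μ * a).eval t₀ = 0 := by
      simp only [eval_sub, eval_mul, eval_C, hμ]
      field_simp
      ring
    rw [h2] at h1
    simpa [ha0] using h1
  obtain ⟨c', hc'⟩ := sq_dvd_of_nonneg hc hc0
  have hfac : D - C μ * a = (X - C t₀) ^ 2 * (a * c' - b' ^ 2) := by
    have : D - C μ * a = a * r - (b + C z₀ * a) ^ 2 := by
      rw [hid]; ring
    rw [this, hc', hb']
    ring
  refine ⟨μ, t₀, z₀, b', c', div_nonneg (hD t₀) (ha t₀).le, hb', hr ▸ hc', ?_, ?_⟩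
  · refine nonneg_of_nonneg_off (Polynomial.continuous _) t₀ fun t ht => ?_
    have h1 := hDμ t
    rw [hfac, eval_mul] at h1
    refine nonneg_of_mul_nonneg_right h1 ?_
    have : t - t₀ ≠ 0 := sub_ne_zero.mpr ht
    simp only [eval_pow, eval_sub, eval_X, eval_C]
    positivity
  · have h1 : (D - C μ * a).natDegree = D.natDegree :=
      natDegree_sub_eq_left_of_natDegree_lt ((natDegree_C_mul_le _ _).trans_lt hdeg)
    have h2 : a * c' - b' ^ 2 ≠ 0 := by
      intro h
      rw [hfac, h, mul_zero, natDegree_zero] at h1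
      omega
    rw [hfac, ((monic_X_sub_C t₀).pow 2).natDegree_mul' h2, natDegree_pow,
      natDegree_X_sub_C] at h1
    omega

/-- Completing the square in a non-negative quadratic, also when its leading coefficient is zero. -/
lemma exists_complete_square {e₀ e₁ e₂ : ℝ} (h : ∀ t : ℝ, 0 ≤ e₀ + e₁ * t + e₂ * t ^ 2) :
    ∃ α τ β : ℝ, 0 ≤ α ∧ 0 ≤ β ∧ ∀ t : ℝ, e₀ + e₁ * t + e₂ * t ^ 2 = α * (t - τ) ^ 2 + β := by
  have hdisc := discrim_le_zero (a := e₂) (b := e₁) (c := e₀) fun t => by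
    have := h t
    nlinarith
  rw [discrim] at hdisc
  have h0 := h 0
  have h1 := h 1
  have h2 := h (-1)
  by_cases he : e₂ = 0
  · subst he
    have he1 : e₁ = 0 := by nlinarith [sq_nonneg e₁]
    subst he1
    exact ⟨0, 0, e₀, le_rfl, by simpa using h0, fun t => by ring⟩
  · have hpos : 0 < e₂ := by
      refine lt_of_le_of_ne ?_ (Ne.symm he)
      by_contra hcon
      have h3 : e₂ * e₀ ≤ 0 := mul_nonpos_of_nonpos_of_nonneg (by linarith) (by simpa using h0)
      have h4 : e₁ = 0 := by nlinarith [sq_nonneg e₁]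
      have h5 : e₂ * e₀ = 0 := by nlinarith [sq_nonneg e₁]
      have h6 : e₀ = 0 := (mul_eq_zero.mp h5).resolve_left he
      rw [h4, h6] at h1
      linarith
    refine ⟨e₂, -(e₁ / (2 * e₂)), e₀ - e₁ ^ 2 / (4 * e₂), hpos.le, ?_, fun t => ?_⟩
    · have h3 : e₁ ^ 2 / (4 * e₂) ≤ e₀ := by
        rw [div_le_iff₀ (by positivity)]
        linarith
      linarith
    · field_simp
      ring

/-- A positive semidefinite polynomial matrix `[[a, b], [b, c]]` of degrees `2, 3, 4` with `a > 0`
and determinant of degree six, as a quadratic form in `(z, 1)`, is an explicit sum of squares. Two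
applications of `exists_split_off` lower the degrees of `b, c` to `1, 0`; there one completes the
square. -/
lemma exists_sos_of_posSemidef {a b c : ℝ[X]} (ha : ∀ t, 0 < a.eval t)
    (hD : ∀ t, 0 ≤ (a * c - b ^ 2).eval t) (hda : a.natDegree ≤ 2) (hdb : b.natDegree ≤ 3)
    (hdc : c.natDegree ≤ 4) (hdD : (a * c - b ^ 2).natDegree = 6) :
    ∃ μ ν γ α β t₀ z₀ t₁ ζ₀ β₀ β₁ τ : ℝ, 0 ≤ μ ∧ 0 ≤ ν ∧ 0 ≤ γ ∧ 0 ≤ α ∧ 0 ≤ β ∧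
      ∀ t z : ℝ, a.eval t * z ^ 2 + 2 * b.eval t * z + c.eval t =
        μ + ν * (t - t₀) ^ 2 +
        γ * ((t - t₁) * (t - t₀) + (β₀ + β₁ * t) * (z - z₀ - ζ₀ * (t - t₀))) ^ 2 +
        α * ((t - τ) * (z - z₀ - ζ₀ * (t - t₀))) ^ 2 + β * (z - z₀ - ζ₀ * (t - t₀)) ^ 2 := by
  have hCa : ∀ r : ℝ, (C r * a).natDegree ≤ 2 := fun r => (natDegree_C_mul_le _ _).trans hda
  obtain ⟨μ, t₀, z₀, b', c', hμ, hb', hc', hD', hd'⟩ := exists_split_off ha hD (by omega)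
  have hdb' : b'.natDegree ≤ 2 := by
    refine natDegree_le_of_sub_pow_mul (t₀ := t₀) (k := 1) ?_
    rw [pow_one, ← hb']
    exact natDegree_add_le_of_degree_le hdb ((hCa _).trans (by norm_num))
  have hdc' : c'.natDegree ≤ 2 := by
    refine natDegree_le_of_sub_pow_mul (t₀ := t₀) (k := 2) ?_
    rw [← hc']
    exact natDegree_sub_C_add_le hdc (hdb.trans (by norm_num)) (hda.trans (by norm_num))
  obtain ⟨ν, t₁, ζ₀, b'', c'', hν, hb'', hc'', hD'', hd''⟩ := exists_split_off ha hD' (by omega)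
  have hdb'' : b''.natDegree ≤ 1 := by
    refine natDegree_le_of_sub_pow_mul (t₀ := t₁) (k := 1) ?_
    rw [pow_one, ← hb'']
    exact natDegree_add_le_of_degree_le hdb' (hCa _)
  have hdc'' : c''.natDegree ≤ 0 := by
    refine natDegree_le_of_sub_pow_mul (t₀ := t₁) (k := 2) ?_
    rw [← hc'']
    exact natDegree_sub_C_add_le hdc' hdb' hda
  obtain ⟨γ, rfl⟩ : ∃ γ, c'' = C γ := ⟨_, eq_C_of_natDegree_le_zero hdc''⟩
  obtain ⟨β₁, β₀, rfl⟩ := exists_eq_X_add_C_of_natDegree_le_one hdb''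
  obtain ⟨a₀, a₁, a₂, haev⟩ : ∃ a₀ a₁ a₂ : ℝ, ∀ t, a.eval t = a₀ + a₁ * t + a₂ * t ^ 2 := by
    refine ⟨a.coeff 0, a.coeff 1, a.coeff 2, fun t => ?_⟩
    rw [eval_eq_sum_range' (Nat.lt_succ_of_le hda), Finset.sum_range_succ, Finset.sum_range_succ,
      Finset.sum_range_one]
    ring
  have hdet : ∀ t, 0 ≤ a.eval t * γ - (β₁ * t + β₀) ^ 2 := fun t => by simpa using hD'' t
  -- `γ = 0` would force the determinant to vanish, but its degree is still two
  have hγ : 0 < γ := by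
    have h0 : 0 ≤ γ := by
      have h1 := hdet 0
      exact nonneg_of_mul_nonneg_right (by nlinarith [sq_nonneg (β₁ * 0 + β₀)]) (ha 0)
    refine lt_of_le_of_ne h0 fun h => ?_
    subst h
    have h1 := hdet 0
    have h2 := hdet 1
    have hβ₀ : β₀ = 0 := by nlinarith [sq_nonneg β₀]
    have hβ₁ : β₁ = 0 := by subst hβ₀; nlinarith [sq_nonneg β₁]
    subst hβ₀ hβ₁
    simp at hd''
    omega
  obtain ⟨α, τ, β, hα, hβ, hsq⟩ := exists_complete_square (e₀ := a₀ - β₀ ^ 2 / γ)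
    (e₁ := a₁ - 2 * β₀ * β₁ / γ) (e₂ := a₂ - β₁ ^ 2 / γ) fun t => by
      have h1 : 0 ≤ (a.eval t * γ - (β₁ * t + β₀) ^ 2) / γ := div_nonneg (hdet t) hγ.le
      refine h1.trans_eq ?_
      rw [haev]
      field_simp
      ring
  refine ⟨μ, ν, γ, α, β, t₀, z₀, t₁, ζ₀, β₀ / γ, β₁ / γ, τ, hμ, hν, hγ.le, hα, hβ,
    fun t z => ?_⟩
  have e1 := congrArg (eval t) hb'
  have e2 := congrArg (eval t) hc'
  have e3 := congrArg (eval t) hb''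
  have e4 := congrArg (eval t) hc''
  simp only [eval_add, eval_sub, eval_mul, eval_pow, eval_C, eval_X] at e1 e2 e3 e4
  have e5 : a.eval t = α * (t - τ) ^ 2 + β + (β₁ * t + β₀) ^ 2 / γ := by
    rw [← hsq, haev]
    ring
  rw [show c.eval t = (t - t₀) ^ 2 * c'.eval t + μ - 2 * z₀ * b.eval t - z₀ ^ 2 * a.eval t by
      linear_combination e2,
    show b.eval t = (t - t₀) * b'.eval t - z₀ * a.eval t by linear_combination e1,
    show c'.eval t = (t - t₁) ^ 2 * γ + ν - 2 * ζ₀ * b'.eval t - ζ₀ ^ 2 * a.eval t by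
      linear_combination e4,
    show b'.eval t = (t - t₁) * (β₁ * t + β₀) - ζ₀ * a.eval t by linear_combination e3, e5]
  field_simp
  ring

lemma linear_coeff_eq_zero {l a b c : ℝ}
    (h : ∀ s : ℝ, 0 ≤ l * s + a * s ^ 2 + b * s ^ 3 + c * s ^ 4) : l = 0 := by
  have h1 := sq_dvd_of_nonneg (t₀ := 0) (r := C l * X + C a * X ^ 2 + C b * X ^ 3 + C c * X ^ 4)
    (fun s => by simpa using h s) (by simp)
  rw [C_0, sub_zero, X_pow_dvd_iff] at h1
  simpa [coeff_X_pow] using h1 1 (by norm_num)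

/-- The sign conditions on the homogeneous parts `A`, `B`, `D` of degrees two, three and four of a
non-negative polynomial, along a line through a zero. -/
lemma sign_of_nonneg_on_line {A B D : ℝ}
    (h : ∀ s : ℝ, 0 ≤ s ^ 2 * A + s ^ 3 * B + s ^ 4 * D) :
    0 ≤ A ∧ 0 ≤ D ∧ B ^ 2 ≤ 4 * A * D := by
  have h1 : ∀ s : ℝ, 0 ≤ D * (s * s) + B * s + A := by
    refine nonneg_of_nonneg_off (by fun_prop) 0 fun s hs => ?_
    have h2 : 0 ≤ s ^ 2 * (D * (s * s) + B * s + A) := (h s).trans_eq (by ring)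
    exact nonneg_of_mul_nonneg_right h2 (by positivity)
  have h2 : ∀ s : ℝ, 0 ≤ A * (s * s) + B * s + D := by
    refine nonneg_of_nonneg_off (by fun_prop) 0 fun s hs => ?_
    have h3 : 0 ≤ s ^ 2 * (D * (s⁻¹ * s⁻¹) + B * s⁻¹ + A) :=
      mul_nonneg (sq_nonneg s) (h1 s⁻¹)
    refine h3.trans_eq ?_
    field_simp
    ring
  refine ⟨by simpa using h1 0, by simpa using h2 0, ?_⟩
  have := discrim_le_zero h1
  rw [discrim] at this
  linarith

/-- The five-square identity: the bivariate version of `exists_sos_of_posSemidef`, after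
homogenizing with `t = y / x` and `z = 1 / x`. The three coefficient rows are the homogeneous parts
of degrees two, three and four; the hypotheses say that they form a positive semidefinite matrix
with positive first entry, also in the direction `(0, 1)`. -/
lemma exists_five_squares {a₀ a₁ a₂ b₀ b₁ b₂ b₃ c₀ c₁ c₂ c₃ c₄ : ℝ}
    (ha : ∀ t : ℝ, 0 < a₀ + a₁ * t + a₂ * t ^ 2)
    (hD : ∀ t : ℝ, (b₀ + b₁ * t + b₂ * t ^ 2 + b₃ * t ^ 3) ^ 2 ≤
      4 * (a₀ + a₁ * t + a₂ * t ^ 2) * (c₀ + c₁ * t + c₂ * t ^ 2 + c₃ * t ^ 3 + c₄ * t ^ 4))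
    (hinf : b₃ ^ 2 < 4 * a₂ * c₄) :
    ∃ μ ν γ α β t₀ z₀ t₁ ζ₀ β₀ β₁ τ : ℝ, 0 ≤ μ ∧ 0 ≤ ν ∧ 0 ≤ γ ∧ 0 ≤ α ∧ 0 ≤ β ∧
      ∀ x y : ℝ, (a₀ * x ^ 2 + a₁ * (x * y) + a₂ * y ^ 2) +
        (b₀ * x ^ 3 + b₁ * (x ^ 2 * y) + b₂ * (x * y ^ 2) + b₃ * y ^ 3) +
        (c₀ * x ^ 4 + c₁ * (x ^ 3 * y) + c₂ * (x ^ 2 * y ^ 2) +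
          c₃ * (x * y ^ 3) + c₄ * y ^ 4) =
        μ * (x * x) ^ 2 + ν * (x * (y - t₀ * x)) ^ 2 +
        γ * ((y - t₁ * x) * (y - t₀ * x) +
          (β₀ * x + β₁ * y) * (1 - z₀ * x - ζ₀ * (y - t₀ * x))) ^ 2 +
        α * ((y - τ * x) * (1 - z₀ * x - ζ₀ * (y - t₀ * x))) ^ 2 +
        β * (x * (1 - z₀ * x - ζ₀ * (y - t₀ * x))) ^ 2 := by
  let a : ℝ[X] := C a₀ + C a₁ * X + C a₂ * X ^ 2
  let b : ℝ[X] := C (b₀ / 2) + C (b₁ / 2) * X + C (b₂ / 2) * X ^ 2 +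
    C (b₃ / 2) * X ^ 3
  let c : ℝ[X] := C c₀ + C c₁ * X + C c₂ * X ^ 2 + C c₃ * X ^ 3 + C c₄ * X ^ 4
  have hda : a.natDegree ≤ 2 := by simp only [a]; compute_degree
  have hdb : b.natDegree ≤ 3 := by simp only [b]; compute_degree
  have hdc : c.natDegree ≤ 4 := by simp only [c]; compute_degree
  have ea : ∀ t, a.eval t = a₀ + a₁ * t + a₂ * t ^ 2 := fun t => by simp [a]
  have eb : ∀ t, b.eval t = (b₀ + b₁ * t + b₂ * t ^ 2 + b₃ * t ^ 3) / 2 := fun t => by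
    simp [b]; ring
  have ec : ∀ t, c.eval t = c₀ + c₁ * t + c₂ * t ^ 2 + c₃ * t ^ 3 + c₄ * t ^ 4 := fun t => by
    simp [c]
  have hdD : (a * c - b ^ 2).natDegree = 6 := by
    refine natDegree_eq_of_le_of_coeff_ne_zero ?_ ?_
    · exact natDegree_sub_le_of_le (natDegree_mul_le_of_le hda hdc)
        (natDegree_pow_le_of_le 2 hdb)
    · have hb2 : (b ^ 2).coeff 6 = b.coeff 3 ^ 2 := coeff_pow_of_natDegree_le hdb
      rw [coeff_sub, coeff_mul_add_eq_of_natDegree_le hda hdc, hb2]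
      have h1 : a.coeff 2 = a₂ := by simp [a]
      have h2 : b.coeff 3 = b₃ / 2 := by
        simp [b, coeff_X_pow]
      have h3 : c.coeff 4 = c₄ := by
        simp [c, coeff_X_pow]
      rw [h1, h2, h3]
      nlinarith
  obtain ⟨μ, ν, γ, α, β, t₀, z₀, t₁, ζ₀, β₀, β₁, τ, hμ, hν, hγ, hα, hβ, h⟩ :=
    exists_sos_of_posSemidef (a := a) (b := b) (c := c) (fun t => (ha t).trans_eq (ea t).symm)
      (fun t => by
        rw [eval_sub, eval_mul, eval_pow, ea, eb, ec]
        nlinarith [hD t]) hda hdb hdc hdD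
  refine ⟨μ, ν, γ, α, β, t₀, z₀, t₁, ζ₀, β₀, β₁, τ, hμ, hν, hγ, hα, hβ, fun x y => ?_⟩
  -- the substitution covers `x ≠ 0`; the line `x = 0` follows by continuity
  refine congrFun (Continuous.ext_on (dense_compl_singleton (0 : ℝ))
    (f := fun x => (a₀ * x ^ 2 + a₁ * (x * y) + a₂ * y ^ 2) +
        (b₀ * x ^ 3 + b₁ * (x ^ 2 * y) + b₂ * (x * y ^ 2) + b₃ * y ^ 3) +
        (c₀ * x ^ 4 + c₁ * (x ^ 3 * y) + c₂ * (x ^ 2 * y ^ 2) +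
          c₃ * (x * y ^ 3) + c₄ * y ^ 4))
    (g := fun x => μ * (x * x) ^ 2 + ν * (x * (y - t₀ * x)) ^ 2 +
        γ * ((y - t₁ * x) * (y - t₀ * x) +
          (β₀ * x + β₁ * y) * (1 - z₀ * x - ζ₀ * (y - t₀ * x))) ^ 2 +
        α * ((y - τ * x) * (1 - z₀ * x - ζ₀ * (y - t₀ * x))) ^ 2 +
        β * (x * (1 - z₀ * x - ζ₀ * (y - t₀ * x))) ^ 2)
    (by fun_prop) (by fun_prop) fun x hx => ?_) x
  have hx0 : x ≠ 0 := hx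
  have h1 := h (y / x) (1 / x)
  rw [ea, eb, ec] at h1
  have h2 := congrArg (fun r => x ^ 4 * r) h1
  refine (Eq.trans ?_ h2).trans ?_
  · field_simp
  · field_simp

end Univariate

section Hilbert

open MvPolynomial

/-! ### Non-negative bivariate quartics -/

/-- Sums of squares of polynomials of degree at most two. -/
def sosCone : AddSubmonoid (MvPolynomial (Fin 2) ℝ) :=
  AddSubmonoid.closure {q | ∃ g : MvPolynomial (Fin 2) ℝ, g.totalDegree ≤ 2 ∧ q = g * g}

lemma smul_mul_self_mem_sosCone {r : ℝ} (hr : 0 ≤ r) {g : MvPolynomial (Fin 2) ℝ}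
    (hg : g.totalDegree ≤ 2) : C r * (g * g) ∈ sosCone := by
  refine AddSubmonoid.subset_closure ⟨C (√r) * g, ?_, ?_⟩
  · refine (totalDegree_mul _ _).trans ?_
    simpa using hg
  · have : (C r : MvPolynomial (Fin 2) ℝ) = C (√r) * C (√r) := by rw [← C_mul, Real.mul_self_sqrt hr]
    rw [this]
    ring

lemma riesz_nonneg_of_mem_sosCone {y : Mono (2 * 2) → ℝ} (hy : (momentMatrix 2 y).PosSemidef)
    {q : MvPolynomial (Fin 2) ℝ} (hq : q ∈ sosCone) : 0 ≤ riesz y q := by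
  induction hq using AddSubmonoid.closure_induction with
  | mem q hq =>
    obtain ⟨g, hg, rfl⟩ := hq
    exact riesz_mul_self_nonneg hy hg
  | zero => exact (map_zero (rieszₗ y)).ge
  | add p q _ _ hp hq =>
    have := map_add (rieszₗ y) p q
    simp only [rieszₗ_apply] at this
    rw [this]
    exact add_nonneg hp hq

/-- The polynomial `q(x + v)`. -/
def translate (v : Fin 2 → ℝ) (q : MvPolynomial (Fin 2) ℝ) : MvPolynomial (Fin 2) ℝ :=
  bind₁ (fun i => X i + C (v i)) q

lemma eval_translate (v : Fin 2 → ℝ) (q : MvPolynomial (Fin 2) ℝ) (x : Fin 2 → ℝ) :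
    eval x (translate v q) = eval (x + v) q := by
  rw [translate]
  induction q using MvPolynomial.induction_on with
  | C r => simp
  | add p q hp hq => simp [hp, hq]
  | mul_X p i hp => simp [hp]

lemma totalDegree_translate_le (v : Fin 2 → ℝ) {q : MvPolynomial (Fin 2) ℝ} {d : ℕ}
    (hq : q.totalDegree ≤ d) : (translate v q).totalDegree ≤ d := by
  rw [sum_monomial_of_totalDegree_le hq, translate, map_sum]
  refine totalDegree_finsetSum_le fun a _ => ?_
  rw [bind₁_monomial]
  have hX : ∀ i, (X i + C (v i) : MvPolynomial (Fin 2) ℝ).totalDegree ≤ 1 := fun i =>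
    (totalDegree_add _ _).trans (by simp)
  refine (totalDegree_mul _ _).trans ?_
  rw [totalDegree_C, zero_add]
  refine (totalDegree_finsetProd _ _).trans ?_
  calc ∑ i ∈ a.toFinsupp.support,
        ((X i + C (v i) : MvPolynomial (Fin 2) ℝ) ^ a.toFinsupp i).totalDegree
      ≤ ∑ i ∈ a.toFinsupp.support, a.toFinsupp i := Finset.sum_le_sum fun i _ =>
        (totalDegree_pow _ _).trans (by simpa using Nat.mul_le_mul_left (a.toFinsupp i) (hX i))
    _ ≤ ∑ i, a.toFinsupp i := Finset.sum_le_sum_of_subset (Finset.subset_univ _)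
    _ ≤ d := by
      rw [Fin.sum_univ_two, Mono.toFinsupp_zero, Mono.toFinsupp_one]
      exact a.2

lemma translate_mem_sosCone (v : Fin 2 → ℝ) {q : MvPolynomial (Fin 2) ℝ} (hq : q ∈ sosCone) :
    translate v q ∈ sosCone := by
  induction hq using AddSubmonoid.closure_induction with
  | mem q hq =>
    obtain ⟨g, hg, rfl⟩ := hq
    exact AddSubmonoid.subset_closure
      ⟨translate v g, totalDegree_translate_le v hg, map_mul _ _ _⟩
  | zero => simp [translate]
  | add p q _ _ hp hq =>
    rw [translate, map_add]
    exact add_mem hp hq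

/-- The fifteen coefficients of a bivariate quartic, sorted by degree. -/
lemma exists_coeffs {q : MvPolynomial (Fin 2) ℝ} (hq : q.totalDegree ≤ 4) :
    ∃ k l₀ l₁ a₀ a₁ a₂ b₀ b₁ b₂ b₃ c₀ c₁ c₂ c₃ c₄ : ℝ, ∀ x : Fin 2 → ℝ,
      eval x q = k + (l₀ * x 0 + l₁ * x 1) + (a₀ * x 0 ^ 2 + a₁ * (x 0 * x 1) + a₂ * x 1 ^ 2) +
        (b₀ * x 0 ^ 3 + b₁ * (x 0 ^ 2 * x 1) + b₂ * (x 0 * x 1 ^ 2) + b₃ * x 1 ^ 3) +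
        (c₀ * x 0 ^ 4 + c₁ * (x 0 ^ 3 * x 1) + c₂ * (x 0 ^ 2 * x 1 ^ 2) +
          c₃ * (x 0 * x 1 ^ 3) + c₄ * x 1 ^ 4) := by
  let κ : ℕ → ℕ → ℝ := fun i j => coeff (Finsupp.single 0 i + Finsupp.single 1 j) q
  refine ⟨κ 0 0, κ 1 0, κ 0 1, κ 2 0, κ 1 1, κ 0 2, κ 3 0, κ 2 1, κ 1 2, κ 0 3, κ 4 0, κ 3 1,
    κ 2 2, κ 1 3, κ 0 4, fun x => ?_⟩
  rw [eval_eq_sum hq]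
  have h : ∑ a : Mono 4, coeff a.toFinsupp q * pointMoment 4 x a =
      ∑ a : Fin 5 × Fin 5, if a.1.val + a.2.val ≤ 4 then
        κ a.1.val a.2.val * (x 0 ^ a.1.val * x 1 ^ a.2.val) else 0 := by
    rw [← Finset.sum_filter]
    exact (Finset.sum_subtype (p := fun a : Fin 5 × Fin 5 => a.1.val + a.2.val ≤ 4) _ (by simp)
      (fun a => κ a.1.val a.2.val * (x 0 ^ a.1.val * x 1 ^ a.2.val))).symm
  rw [h, Fintype.sum_prod_type]
  simp only [Fin.sum_univ_five]
  simp
  ring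

/-- A non-negative quartic with a zero at the origin becomes a sum of squares after an arbitrarily
small perturbation that keeps the zero. -/
lemma add_perturbation_mem_sosCone {q : MvPolynomial (Fin 2) ℝ} (hq : q.totalDegree ≤ 4)
    (hnn : ∀ x, 0 ≤ eval x q) (h0 : eval 0 q = 0) {δ : ℝ} (hδ : 0 < δ) :
    q + C δ * ((X 0 ^ 2 + X 1 ^ 2) + (X 0 ^ 2 + X 1 ^ 2) ^ 2) ∈ sosCone := by
  obtain ⟨k, l₀, l₁, a₀, a₁, a₂, b₀, b₁, b₂, b₃, c₀, c₁, c₂, c₃, c₄, hev⟩ := exists_coeffs hq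
  have hk : k = 0 := by
    rw [hev] at h0
    simpa using h0
  subst hk
  have hl₀ : l₀ = 0 := linear_coeff_eq_zero (a := a₀) (b := b₀) (c := c₀) fun s =>
    (hnn ![s, 0]).trans_eq (by rw [hev]; simp)
  have hl₁ : l₁ = 0 := linear_coeff_eq_zero (a := a₂) (b := b₃) (c := c₄) fun s =>
    (hnn ![0, s]).trans_eq (by rw [hev]; simp)
  subst hl₀ hl₁
  have hdir : ∀ t : ℝ, 0 ≤ a₀ + a₁ * t + a₂ * t ^ 2 ∧
      0 ≤ c₀ + c₁ * t + c₂ * t ^ 2 + c₃ * t ^ 3 + c₄ * t ^ 4 ∧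
      (b₀ + b₁ * t + b₂ * t ^ 2 + b₃ * t ^ 3) ^ 2 ≤ 4 * (a₀ + a₁ * t + a₂ * t ^ 2) *
        (c₀ + c₁ * t + c₂ * t ^ 2 + c₃ * t ^ 3 + c₄ * t ^ 4) := fun t =>
    sign_of_nonneg_on_line fun s => (hnn ![s, s * t]).trans_eq (by rw [hev]; simp; ring)
  obtain ⟨ha₂, hc₄, hb₃⟩ : 0 ≤ a₂ ∧ 0 ≤ c₄ ∧ b₃ ^ 2 ≤ 4 * a₂ * c₄ :=
    sign_of_nonneg_on_line fun s => (hnn ![0, s]).trans_eq (by rw [hev]; simp; ring)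
  -- the perturbation adds `δ (1 + t²)` to `a` and `δ (1 + t²)²` to `c`
  obtain ⟨μ, ν, γ, α, β, t₀, z₀, t₁, ζ₀, β₀, β₁, τ, hμ, hν, hγ, hα, hβ, h⟩ :=
    exists_five_squares (a₀ := a₀ + δ) (a₁ := a₁) (a₂ := a₂ + δ) (b₀ := b₀) (b₁ := b₁) (b₂ := b₂)
      (b₃ := b₃) (c₀ := c₀ + δ) (c₁ := c₁) (c₂ := c₂ + 2 * δ) (c₃ := c₃) (c₄ := c₄ + δ)
      (fun t => by
        have : 0 < δ * (1 + t ^ 2) := by positivity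
        linarith [(hdir t).1])
      (fun t => by
        obtain ⟨h1, h2, h3⟩ := hdir t
        have h4 : 0 ≤ δ * (1 + t ^ 2) := by positivity
        have h5 : 0 ≤ δ * (1 + t ^ 2) ^ 2 := by positivity
        have h6 := mul_nonneg h1 h5
        have h7 := mul_nonneg h4 h2
        have h8 := mul_nonneg h4 h5
        linarith)
      (by nlinarith [mul_nonneg ha₂ hδ.le, mul_nonneg hδ.le hc₄, mul_pos hδ hδ])
  have hmul : ∀ f g : Fin 3 → ℝ, (affineForm f * affineForm g).totalDegree ≤ 2 := fun f g =>
    (totalDegree_mul _ _).trans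
      (add_le_add (totalDegree_affineForm_le f) (totalDegree_affineForm_le g))
  let x : MvPolynomial (Fin 2) ℝ := affineForm ![0, 1, 0]
  let u : MvPolynomial (Fin 2) ℝ := affineForm ![0, -t₀, 1]
  let e : MvPolynomial (Fin 2) ℝ := affineForm ![1, ζ₀ * t₀ - z₀, -ζ₀]
  let g : MvPolynomial (Fin 2) ℝ := affineForm ![0, -t₁, 1] * u + affineForm ![0, β₀, β₁] * e
  let w : MvPolynomial (Fin 2) ℝ := affineForm ![0, -τ, 1]
  have hg : g.totalDegree ≤ 2 := (totalDegree_add _ _).trans (max_le (hmul _ _) (hmul _ _))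
  have hsum : q + C δ * ((X 0 ^ 2 + X 1 ^ 2) + (X 0 ^ 2 + X 1 ^ 2) ^ 2) =
      C μ * ((x * x) * (x * x)) + C ν * ((x * u) * (x * u)) + C γ * (g * g) +
        C α * ((w * e) * (w * e)) + C β * ((x * e) * (x * e)) := by
    refine MvPolynomial.funext fun v => ?_
    have h1 := h (v 0) (v 1)
    simp only [map_add, map_mul, map_pow, eval_C, eval_X, hev, x, u, e, g, w, eval_affineForm,
      Matrix.cons_val_zero, Matrix.cons_val_one, Matrix.cons_val]
    linear_combination h1
  rw [hsum]
  exact add_mem (add_mem (add_mem (add_mem (smul_mul_self_mem_sosCone hμ (hmul _ _))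
    (smul_mul_self_mem_sosCone hν (hmul _ _))) (smul_mul_self_mem_sosCone hγ hg))
    (smul_mul_self_mem_sosCone hα (hmul _ _))) (smul_mul_self_mem_sosCone hβ (hmul _ _))

lemma nonneg_of_forall_pos_add_mul {A B : ℝ} (h : ∀ ε : ℝ, 0 < ε → 0 ≤ A + ε * B) : 0 ≤ A := by
  have hc : Filter.Tendsto (fun ε : ℝ => A + ε * B) (nhdsWithin 0 (Set.Ioi 0)) (nhds A) := by
    have : Continuous fun ε : ℝ => A + ε * B := by fun_prop
    simpa using (this.tendsto 0).mono_left nhdsWithin_le_nhds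
  exact ge_of_tendsto hc (Filter.eventually_of_mem self_mem_nhdsWithin fun ε hε => h ε hε)

/-- A coercive perturbation of a non-negative polynomial attains its minimum. -/
lemma exists_min_perturbed {q : MvPolynomial (Fin 2) ℝ} (hnn : ∀ x, 0 ≤ eval x q) {ε : ℝ}
    (hε : 0 < ε) : ∃ v, ∀ x, eval v (q + C ε * (1 + X 0 ^ 2 + X 1 ^ 2) ^ 2) ≤
      eval x (q + C ε * (1 + X 0 ^ 2 + X 1 ^ 2) ^ 2) := by
  refine Continuous.exists_forall_le (MvPolynomial.continuous_eval _) ?_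
  refine Filter.tendsto_atTop_mono (f := fun x : Fin 2 → ℝ => ε * ‖x‖) (fun x => ?_)
    ((tendsto_norm_cocompact_atTop).const_mul_atTop hε)
  have h1 : ‖x‖ ≤ 1 + x 0 ^ 2 + x 1 ^ 2 := by
    rw [pi_norm_le_iff_of_nonneg (by positivity)]
    intro i
    rw [Real.norm_eq_abs, abs_le]
    fin_cases i
    · simp only [Fin.zero_eta]
      constructor <;> nlinarith [sq_nonneg (x 0 - 1), sq_nonneg (x 0 + 1), sq_nonneg (x 1)]
    · simp only [Fin.mk_one]
      constructor <;> nlinarith [sq_nonneg (x 1 - 1), sq_nonneg (x 1 + 1), sq_nonneg (x 0)]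
  have h2 : 1 + x 0 ^ 2 + x 1 ^ 2 ≤ (1 + x 0 ^ 2 + x 1 ^ 2) ^ 2 := by
    nlinarith [sq_nonneg (x 0), sq_nonneg (x 1)]
  have h3 := mul_le_mul_of_nonneg_left (h1.trans h2) hε.le
  simp only [map_add, map_mul, map_pow, eval_C, eval_X, map_one]
  linarith [hnn x]

/-- Hilbert's theorem on ternary quartics, in dual and dehomogenized form: a functional with
positive semidefinite moment matrix is non-negative on non-negative bivariate quartics. -/
theorem riesz_nonneg_of_nonneg {y : Mono (2 * 2) → ℝ} (hy : (momentMatrix 2 y).PosSemidef)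
    {q : MvPolynomial (Fin 2) ℝ} (hq : q.totalDegree ≤ 4) (hnn : ∀ x, 0 ≤ eval x q) :
    0 ≤ riesz y q := by
  have hlin : ∀ (A B : MvPolynomial (Fin 2) ℝ) (r : ℝ),
      riesz y (A + C r * B) = riesz y A + r * riesz y B := fun A B r => by
    rw [← smul_eq_C_mul]
    simp only [← rieszₗ_apply, map_add, map_smul, smul_eq_mul]
  have hone : 0 ≤ riesz y 1 := by
    simpa using riesz_mul_self_nonneg hy (g := 1) (by simp)
  have hsq : ∀ i : Fin 2, ((X i : MvPolynomial (Fin 2) ℝ) ^ 2).totalDegree ≤ 2 := fun i =>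
    (totalDegree_pow _ _).trans (by simp)
  have hbump : ((1 + X 0 ^ 2 + X 1 ^ 2) ^ 2 : MvPolynomial (Fin 2) ℝ).totalDegree ≤ 4 := by
    refine (totalDegree_pow _ _).trans ?_
    have : (1 + X 0 ^ 2 + X 1 ^ 2 : MvPolynomial (Fin 2) ℝ).totalDegree ≤ 2 :=
      (totalDegree_add _ _).trans (max_le ((totalDegree_add _ _).trans
        (max_le (by simp) (hsq 0))) (hsq 1))
    omega
  refine nonneg_of_forall_pos_add_mul (B := riesz y ((1 + X 0 ^ 2 + X 1 ^ 2) ^ 2)) fun ε hε => ?_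
  rw [← hlin]
  obtain ⟨v, hv⟩ := exists_min_perturbed hnn hε
  set r := q + C ε * (1 + X 0 ^ 2 + X 1 ^ 2) ^ 2 with hr
  have hrdeg : r.totalDegree ≤ 4 := by
    refine (totalDegree_add _ _).trans (max_le hq ((totalDegree_mul _ _).trans ?_))
    simpa using hbump
  set m := eval v r with hm
  have hm0 : 0 ≤ m := by
    rw [hm, hr]
    simp only [map_add, map_mul, map_pow, eval_C, eval_X, map_one]
    have := hnn v
    positivity
  have hdeg' : (translate v (r - C m)).totalDegree ≤ 4 :=
    totalDegree_translate_le v ((totalDegree_sub _ _).trans (max_le hrdeg (by simp)))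
  set N : MvPolynomial (Fin 2) ℝ := (X 0 ^ 2 + X 1 ^ 2) + (X 0 ^ 2 + X 1 ^ 2) ^ 2 with hN
  have hback : ∀ A, translate (-v) (translate v A) = A := fun A =>
    MvPolynomial.funext fun x => by simp [eval_translate]
  have hshift : 0 ≤ riesz y (r - C m) := by
    refine nonneg_of_forall_pos_add_mul (B := riesz y (translate (-v) N)) fun δ hδ => ?_
    rw [← hlin]
    have h1 := translate_mem_sosCone (-v) (add_perturbation_mem_sosCone hdeg'
      (fun x => by rw [eval_translate, map_sub, eval_C]; linarith [hv (x + v)])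
      (by rw [eval_translate]; simp [hm]) hδ)
    refine riesz_nonneg_of_mem_sosCone hy ?_
    have h2 : translate (-v) (translate v (r - C m) + C δ * N) =
        (r - C m) + C δ * translate (-v) N := by
      conv_rhs => rw [← hback (r - C m)]
      simp [translate]
    rwa [← h2]
  have h3 : riesz y r = riesz y (r - C m) + m * riesz y 1 := by
    rw [← hlin]; simp
  rw [h3]
  positivity

end Hilbert

end PlaneQuartic

end

theorem lemma2 (p : MvPolynomial (Fin 2) ℝ)
    (hdeg : p.totalDegree = 4)
    (hint : (interior (PlaneQuartic.hull p)).Nonempty)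
    (hclosed : IsClosed (PlaneQuartic.hull p))
    (hsign : {x : Fin 2 → ℝ | 0 ≤ MvPolynomial.eval x p} ⊆ PlaneQuartic.hull p)
    (hpos : ∃ x : Fin 2 → ℝ, 0 < MvPolynomial.eval x p) :
    (PlaneQuartic.hull p = PlaneQuartic.relaxation p 2 ↔
      ∀ f ∈ PlaneQuartic.dualCone p, (f 1 ≠ 0 ∨ f 2 ≠ 0) →
        ∃ c : ℝ, 0 < c ∧
          ∀ x : Fin 2 → ℝ, 0 ≤ MvPolynomial.eval x (PlaneQuartic.pf p (c • f))) ∧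
    ∃ m : ℕ, m ≤ 12 ∧ PlaneQuartic.HasSemidefiniteRep (PlaneQuartic.relaxation p 2) m := by
  refine ⟨⟨fun heq f hf hne => ?_, fun hscale => ?_⟩,
    12, le_rfl, PlaneQuartic.hasSemidefiniteRep_relaxation_two p⟩
  · exact PlaneQuartic.exists_scaling_of_relaxation_subset hdeg.le hsign hpos heq.ge hf hne
  · refine (PlaneQuartic.hull_subset_relaxation_two hdeg.le).antisymm fun x hx => ?_
    by_contra hxn
    obtain ⟨f, hf, hne, hneg⟩ :=
      PlaneQuartic.exists_mem_dualCone_neg hclosed (hint.mono interior_subset) hxn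
    obtain ⟨c, hc, hnn⟩ := hscale f hf hne
    obtain ⟨y, h0, h1, h2, hM, hp⟩ := PlaneQuartic.mem_relaxation_two.mp hx
    have hL := PlaneQuartic.riesz_nonneg_of_nonneg hM
      (PlaneQuartic.totalDegree_pf_le hdeg.le (c • f)) hnn
    rw [PlaneQuartic.riesz_pf, hp, h0, h1, h2] at hL
    rw [PlaneQuartic.eval_affineForm] at hneg
    simp only [Pi.smul_apply, smul_eq_mul] at hL
    nlinarith [mul_neg_of_pos_of_neg hc hneg]
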